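/- Conventions. Locally compact groups and spaces are Hausdorff. A locally compact group $G$ is *amenable* if there is a left invariant mean on $C_b(G)$, i.e. a positive linear functional $M$ on the bounded continuous real functions on $G$ with $M(1)=1$ and $M(f(g\,\cdot))=M(f)$ for all $g\in G$ (equivalently, a left invariant mean on $L^\infty(G)$). If $G$ acts measurably on a probability space $(X,m)$ preserving $m$, let $L^2_0(X,m)$ be the space of (classes of) complex square integrable functions $f$ with $\int_X f\,dm=0$, with the unitary representation $(gf)(x)=f(g^{-1}x)$. The action has *spectral gap* if this representation does not contain almost invariant vectors, i.e. if it is not true that for every compact $K\subset G$ and every $\varepsilon>0$ there is a nonzero $f\in L^2_0(X,m)$ with $\|gf-f\|_2<\varepsilon\|f\|_2$ for all $g\in K$. A subgroup $H\le G$ is *of finite covolume* if it is closed and $G/H$ carries a $G$-invariant Borel probability measure (which is then unique); *cocompact* if it is closed and $G/H$ is compact; *weakly cocompact* if it is closed, of finite covolume, and the action of $G$ on $G/H$ with its invariant probability measure has spectral gap. **Proposition.** Let $G$ be an amenable second countable locally compact group. 1. Let $H\le G$ be a closed subgroup of finite covolume. Then $H$ is cocompact if and only if $H$ is weakly cocompact.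 2. Let $X$ be a $\sigma$-compact locally compact space on which $G$ acts continuously, preserving a Borel probability measure $m$ of full support. If $X$ is not compact, then the action of $G$ on $(X,m)$ does not have spectral gap. -/

import Mathlib

open MeasureTheory
open scoped BoundedContinuousFunction

namespace AmenableLattice

section Amenability

variable (G : Type*) [Group G] [TopologicalSpace G] [IsTopologicalGroup G]

/-- A left invariant mean on the space of bounded continuous real functions on `G`:
a positive normalized linear functional that is invariant under all left translations. -/
structure LeftInvariantMean where
  /-- the underlying linear functional -/
  toLinearMap : (G →ᵇ ℝ) →ₗ[ℝ] ℝ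
  nonneg : ∀ f : G →ᵇ ℝ, (∀ x, 0 ≤ f x) → 0 ≤ toLinearMap f
  map_one : toLinearMap (BoundedContinuousFunction.const G 1) = 1
  left_invariant : ∀ (g : G) (f : G →ᵇ ℝ),
    toLinearMap (f.compContinuous ⟨fun x => g * x, continuous_const_mul g⟩) = toLinearMap f

/-- Amenability of a (locally compact) group: there is a left invariant mean on the bounded
continuous functions. A left invariant mean on `L^∞(G)` restricts to one, and for locally compact
groups the two existence statements are well known to be equivalent. -/
def IsAmenable : Prop := Nonempty (LeftInvariantMean G)

end Amenability

section SpectralGap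

/-- A representation `ρ` of a topological group contains almost invariant vectors if for every
compact `K ⊆ G` and every `ε > 0` there is a nonzero `(K, ε)`-invariant vector. -/
def HasAlmostInvariantVectors {G : Type*} [Group G] [TopologicalSpace G]
    {V : Type*} [NormedAddCommGroup V] [Module ℂ V] (ρ : Representation ℂ G V) : Prop :=
  ∀ K : Set G, IsCompact K → ∀ ε : ℝ, 0 < ε →
    ∃ v : V, v ≠ 0 ∧ ∀ g ∈ K, ‖ρ g v - v‖ < ε * ‖v‖

variable {X : Type*} [MeasurableSpace X] (m : Measure X)

/-- The space `L²₀(X, m)` of classes of square integrable complex functions of integral zero. -/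
def L2Zero [IsFiniteMeasure m] : Submodule ℂ (Lp ℂ 2 m) where
  carrier := {f | ∫ x, f x ∂m = 0}
  zero_mem' := by
    change ∫ x, (0 : Lp ℂ 2 m) x ∂m = 0
    rw [integral_congr_ae (Lp.coeFn_zero ℂ 2 m)]
    simp
  add_mem' := by
    intro f g hf hg
    change ∫ x, (f + g) x ∂m = 0
    change ∫ x, f x ∂m = 0 at hf
    change ∫ x, g x ∂m = 0 at hg
    rw [integral_congr_ae (Lp.coeFn_add f g)]
    simp only [Pi.add_apply]
    rw [integral_add ((Lp.memLp f).integrable one_le_two) ((Lp.memLp g).integrable one_le_two),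
      hf, hg, add_zero]
  smul_mem' := by
    intro c f hf
    change ∫ x, (c • f) x ∂m = 0
    change ∫ x, f x ∂m = 0 at hf
    rw [integral_congr_ae (Lp.coeFn_smul c f)]
    simp only [Pi.smul_apply]
    rw [integral_smul, hf, smul_zero]

variable {G : Type*} [Group G] [MulAction G X] [MeasurableConstSMul G X]
  [SMulInvariantMeasure G X m]

/-- Translation `f ↦ f (g⁻¹ • ·)` on `L²(X, m)`. -/
noncomputable def translate (g : G) : Lp ℂ 2 m →ₗ[ℂ] Lp ℂ 2 m :=
  Lp.compMeasurePreservingₗ ℂ (fun x : X => g⁻¹ • x) (measurePreserving_smul g⁻¹ m)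

theorem translate_ae_eq (g : G) (f : Lp ℂ 2 m) :
    translate m g f =ᵐ[m] fun x => f (g⁻¹ • x) :=
  Lp.coeFn_compMeasurePreserving f (measurePreserving_smul g⁻¹ m)

theorem norm_translate (g : G) (f : Lp ℂ 2 m) : ‖translate m g f‖ = ‖f‖ :=
  Lp.norm_compMeasurePreserving f (measurePreserving_smul g⁻¹ m)

theorem translate_mem_L2Zero [IsFiniteMeasure m] (g : G) {f : Lp ℂ 2 m} (hf : f ∈ L2Zero m) :
    translate m g f ∈ L2Zero m := by
  change ∫ x, f x ∂m = 0 at hf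
  change ∫ x, translate m g f x ∂m = 0
  rw [integral_congr_ae (translate_ae_eq m g f)]
  have h := (measurePreserving_smul g⁻¹ m).integral_comp
    (measurableEmbedding_const_smul g⁻¹) (fun x => f x)
  rw [h, hf]

variable (G) [IsFiniteMeasure m]

/-- The unitary representation of `G` on `L²₀(X, m)` attached to a measure preserving action,
`(g f)(x) = f (g⁻¹ x)`. -/
noncomputable def koopman : Representation ℂ G (L2Zero m) where
  toFun g := (translate m g).restrict fun _ hf => translate_mem_L2Zero m g hf
  map_one' := by
    ext1 f
    apply Subtype.ext
    apply Lp.ext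
    refine (translate_ae_eq m (1 : G) f.1).trans ?_
    simp
  map_mul' g h := by
    ext1 f
    apply Subtype.ext
    apply Lp.ext
    refine (translate_ae_eq m (g * h) f.1).trans ?_
    change _ =ᵐ[m] translate m g (translate m h f.1)
    refine Filter.EventuallyEq.trans ?_ (translate_ae_eq m g (translate m h f.1)).symm
    have := (measurePreserving_smul g⁻¹ m).quasiMeasurePreserving.ae_eq_comp
      (translate_ae_eq m h f.1)
    refine Filter.EventuallyEq.trans ?_ this.symm
    simp [Function.comp_def, mul_smul]

/-- The measure preserving action of `G` on `(X, m)` has spectral gap: the unitary representation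
on `L²₀(X, m)` does not contain almost invariant vectors. -/
def HasSpectralGap [TopologicalSpace G] : Prop := ¬ HasAlmostInvariantVectors (koopman m G)

end SpectralGap

section Subgroups

variable {G : Type*} [Group G] [TopologicalSpace G] [IsTopologicalGroup G] (H : Subgroup G)

/-- `H` is closed and `G ⧸ H` carries a `G`-invariant Borel probability measure. -/
def HasFiniteCovolume : Prop :=
  letI : MeasurableSpace (G ⧸ H) := borel (G ⧸ H)
  IsClosed (H : Set G) ∧
    ∃ m : Measure (G ⧸ H), IsProbabilityMeasure m ∧ SMulInvariantMeasure G (G ⧸ H) m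

/-- `H` is closed and `G ⧸ H` is compact. -/
def IsCocompact : Prop := IsClosed (H : Set G) ∧ CompactSpace (G ⧸ H)

/-- `H` is closed of finite covolume and the action of `G` on `G ⧸ H`, with its (unique)
invariant Borel probability measure, has spectral gap. -/
def IsWeaklyCocompact : Prop :=
  letI : MeasurableSpace (G ⧸ H) := borel (G ⧸ H)
  haveI : BorelSpace (G ⧸ H) := ⟨rfl⟩
  IsClosed (H : Set G) ∧
    ∃ (m : Measure (G ⧸ H)) (_ : IsProbabilityMeasure m) (_ : SMulInvariantMeasure G (G ⧸ H) m),
      HasSpectralGap m G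

end Subgroups

end AmenableLattice

namespace AmenableLattice

open Filter Topology Set
open scoped Pointwise

universe u

set_option linter.unusedSectionVars false

/-! ### Weak integrals of bounded continuous vector functions against `L¹` densities -/

section Pairing

variable {α V W : Type*} [TopologicalSpace α] [SecondCountableTopology α] [MeasurableSpace α]
  [OpensMeasurableSpace α] [NormedAddCommGroup V] [NormedSpace ℝ V]
  [NormedAddCommGroup W] [NormedSpace ℝ W] (μ : Measure α)

/-! Noncompact spaces have no gap because amenability yields averaging weights with bounded reach in
`G`. By `LeftInvariantMean.exists_almost_invariant_average`, a compactly supported density `b` and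
finitely many coefficients `c j` at points `h j` make `∑ c j ∫ b(s) τ(s h_j) f ds` almost
`K`-invariant for every isometric representation `τ` and every `f` with continuous orbit. The
weights are fixed before `f`. So one can take a compact `K₀` of measure at least `3/4`, note that
its translates by the inverses of the averaging elements stay in a compact `Q ≠ X`, and choose a
nonzero continuous `f ≥ 0` vanishing on `Q`. The average `F` in `L¹(X)` vanishes on `K₀` and keeps
the integral of `f`. Then `√|F|` minus its mean is almost invariant in `L²₀`, and it is not small
because `√|F|` vanishes on most of `X` (`exists_mem_L2Zero_of_L1`).

The weights come from the passage from invariant means to Reiter's condition: Hahn–Banach turns the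
mean into norm-small convex combinations for finitely many densities of integral zero
(`LeftInvariantMean.exists_convexCombination`). Convolving with a bump `e` makes the coefficient
functions uniformly continuous, so that a mean on `C_b(G)` suffices, and a finite cover extends the
estimate to all of `K`.

Conversely, if `G ⧸ H` is compact, some compact `L ⊆ G` carries every point to every other. The
variance of `v ∈ L²₀` is then bounded by an average of `‖g v - v‖²` over a compact set, which
prevents almost invariance (`hasSpectralGap_of_compact_transitive`); amenability plays no role here.
-/

theorem integrable_smul_bcf {p : α → ℝ} (hp : Integrable p μ) (o : α →ᵇ V) :
    Integrable (fun s => p s • o s) μ :=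
  hp.smul_bdd ‖o‖ o.continuous.aestronglyMeasurable (ae_of_all _ o.norm_coe_le_norm)

/-- Integration of integrable functions against a bounded continuous vector valued function. -/
noncomputable def pairing (o : α →ᵇ V) : Lp ℝ 1 μ →L[ℝ] V :=
  LinearMap.mkContinuous
    { toFun := fun p => ∫ s, p s • o s ∂μ
      map_add' := fun p q => by
        rw [← integral_add (integrable_smul_bcf μ (L1.integrable_coeFn p) o)
          (integrable_smul_bcf μ (L1.integrable_coeFn q) o)]
        refine integral_congr_ae ?_
        filter_upwards [Lp.coeFn_add p q] with s hs
        rw [hs, Pi.add_apply, add_smul]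
      map_smul' := fun c p => by
        rw [RingHom.id_apply, ← integral_smul]
        refine integral_congr_ae ?_
        filter_upwards [Lp.coeFn_smul c p] with s hs
        rw [hs, Pi.smul_apply, smul_assoc] }
    ‖o‖ fun p => by
      rw [L1.norm_eq_integral_norm, ← integral_const_mul]
      refine norm_integral_le_of_norm_le ((L1.integrable_coeFn p).norm.const_mul _)
        (ae_of_all _ fun s => ?_)
      rw [norm_smul, mul_comm]
      exact mul_le_mul_of_nonneg_right (o.norm_coe_le_norm s) (norm_nonneg _)

theorem pairing_apply (o : α →ᵇ V) (p : Lp ℝ 1 μ) : pairing μ o p = ∫ s, p s • o s ∂μ := rfl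

theorem norm_pairing_le (o : α →ᵇ V) (p : Lp ℝ 1 μ) : ‖pairing μ o p‖ ≤ ‖o‖ * ‖p‖ :=
  (pairing μ o).le_of_opNorm_le (LinearMap.mkContinuous_norm_le _ (norm_nonneg _) _) p

theorem map_pairing [CompleteSpace V] [CompleteSpace W] (T : V →L[ℝ] W) (o : α →ᵇ V)
    (p : Lp ℝ 1 μ) : T (pairing μ o p) = ∫ s, p s • T (o s) ∂μ := by
  rw [pairing_apply, ← T.integral_comp_comm (integrable_smul_bcf μ (L1.integrable_coeFn p) o)]
  simp

end Pairing

/-! ### Translations on `L¹(G)` and their continuity -/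

section Translations

variable {G : Type u} [Group G] [TopologicalSpace G] [IsTopologicalGroup G]
  [T2Space G] [LocallyCompactSpace G] [SecondCountableTopology G] [MeasurableSpace G]
  [BorelSpace G]

/-- Left translation `q ↦ q (g⁻¹ * ·)` on `L¹` of a left invariant measure. -/
noncomputable def leftTranslate (μ : Measure G) [μ.IsMulLeftInvariant] (g : G) :
    Lp ℝ 1 μ →ₗᵢ[ℝ] Lp ℝ 1 μ :=
  Lp.compMeasurePreservingₗᵢ ℝ (g⁻¹ * ·) (measurePreserving_mul_left μ g⁻¹)

/-- Right translation `e ↦ e (· * g⁻¹)` on `L¹` of a right invariant measure. -/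
noncomputable def rightTranslate (ν : Measure G) [ν.IsMulRightInvariant] (g : G) :
    Lp ℝ 1 ν →ₗᵢ[ℝ] Lp ℝ 1 ν :=
  Lp.compMeasurePreservingₗᵢ ℝ (· * g⁻¹) (measurePreserving_mul_right ν g⁻¹)

theorem leftTranslate_ae (μ : Measure G) [μ.IsMulLeftInvariant] (g : G) (q : Lp ℝ 1 μ) :
    leftTranslate μ g q =ᵐ[μ] fun s => q (g⁻¹ * s) :=
  Lp.coeFn_compMeasurePreserving q (measurePreserving_mul_left μ g⁻¹)

theorem rightTranslate_ae (ν : Measure G) [ν.IsMulRightInvariant] (g : G) (e : Lp ℝ 1 ν) :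
    rightTranslate ν g e =ᵐ[ν] fun s => e (s * g⁻¹) :=
  Lp.coeFn_compMeasurePreserving e (measurePreserving_mul_right ν g⁻¹)

theorem continuous_leftTranslate (μ : Measure G) [μ.IsMulLeftInvariant] [μ.Regular]
    (q : Lp ℝ 1 μ) : Continuous fun g => leftTranslate μ g q := by
  let c : C(G × G, G) := ⟨fun z => z.1⁻¹ * z.2, by fun_prop⟩
  exact continuous_const.compMeasurePreservingLp c.curry.continuous
    (fun g => measurePreserving_mul_left μ g⁻¹) ENNReal.one_ne_top

theorem continuous_rightTranslate (ν : Measure G) [ν.IsMulRightInvariant] [ν.Regular]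
    (e : Lp ℝ 1 ν) : Continuous fun g => rightTranslate ν g e := by
  let c : C(G × G, G) := ⟨fun z => z.2 * z.1⁻¹, by fun_prop⟩
  exact continuous_const.compMeasurePreservingLp c.curry.continuous
    (fun g => measurePreserving_mul_right ν g⁻¹) ENNReal.one_ne_top

theorem rightTranslate_mul (ν : Measure G) [ν.IsMulRightInvariant] (g h : G) (e : Lp ℝ 1 ν) :
    rightTranslate ν (g * h) e = rightTranslate ν h (rightTranslate ν g e) := by
  apply Lp.ext
  refine (rightTranslate_ae ν (g * h) e).trans ?_
  refine EventuallyEq.trans ?_ (rightTranslate_ae ν h _).symm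
  refine EventuallyEq.trans ?_ ((measurePreserving_mul_right ν h⁻¹).quasiMeasurePreserving.ae_eq_comp
    (rightTranslate_ae ν g e)).symm
  simp [Function.comp_def, mul_assoc]

theorem leftTranslate_one (μ : Measure G) [μ.IsMulLeftInvariant] (q : Lp ℝ 1 μ) :
    leftTranslate μ 1 q = q := by
  apply Lp.ext
  refine (leftTranslate_ae μ 1 q).trans ?_
  simp

theorem integral_leftTranslate (μ : Measure G) [μ.IsMulLeftInvariant] (g : G) (q : Lp ℝ 1 μ) :
    ∫ s, leftTranslate μ g q s ∂μ = ∫ s, q s ∂μ := by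
  rw [integral_congr_ae (leftTranslate_ae μ g q), integral_mul_left_eq_self (fun s => q s)]

/-- The map `s ↦ e (· * (s * h)⁻¹)` into `L¹` of a right invariant measure. -/
noncomputable def rightOrbit (ν : Measure G) [ν.IsMulRightInvariant] [ν.Regular]
    (e : Lp ℝ 1 ν) (h : G) : G →ᵇ Lp ℝ 1 ν :=
  BoundedContinuousFunction.ofNormedAddCommGroup (fun s => rightTranslate ν (s * h) e)
    ((continuous_rightTranslate ν e).comp (continuous_mul_const h)) ‖e‖
    fun s => by rw [LinearIsometry.norm_map]

end Translations

/-! ### From an invariant mean to convex combinations -/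

section Mean

variable {G : Type u} [Group G] [TopologicalSpace G] [IsTopologicalGroup G]

theorem LeftInvariantMean.mono (M : LeftInvariantMean G) {f g : G →ᵇ ℝ} (h : ∀ x, f x ≤ g x) :
    M.toLinearMap f ≤ M.toLinearMap g := by
  have := M.nonneg (g - f) fun x => by simpa using h x
  rw [map_sub] at this
  linarith

theorem LeftInvariantMean.map_const (M : LeftInvariantMean G) (c : ℝ) :
    M.toLinearMap (BoundedContinuousFunction.const G c) = c := by
  have : BoundedContinuousFunction.const G c = c • BoundedContinuousFunction.const G (1 : ℝ) := by
    ext; simp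
  rw [this, map_smul, M.map_one, smul_eq_mul, mul_one]

/-- A left invariant mean as a continuous linear functional. -/
noncomputable def LeftInvariantMean.toCLM (M : LeftInvariantMean G) : (G →ᵇ ℝ) →L[ℝ] ℝ :=
  M.toLinearMap.mkContinuous 1 fun f => by
    rw [one_mul, Real.norm_eq_abs, abs_le]
    constructor
    · rw [← M.map_const (-‖f‖)]
      exact M.mono fun x => (abs_le.1 (f.norm_coe_le_norm x)).1
    · rw [← M.map_const ‖f‖]
      exact M.mono fun x => (abs_le.1 (f.norm_coe_le_norm x)).2

variable [T2Space G] [LocallyCompactSpace G] [SecondCountableTopology G] [MeasurableSpace G]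
  [BorelSpace G]

/-- The coefficient `h ↦ Λ (e (· * h⁻¹))`. -/
noncomputable def rightCoeff (ν : Measure G) [ν.IsMulRightInvariant] [ν.Regular]
    (e : Lp ℝ 1 ν) (Λ : Lp ℝ 1 ν →L[ℝ] ℝ) : G →ᵇ ℝ :=
  BoundedContinuousFunction.ofNormedAddCommGroup (fun h => Λ (rightTranslate ν h e))
    (Λ.continuous.comp (continuous_rightTranslate ν e)) (‖Λ‖ * ‖e‖)
    fun h => (Λ.le_opNorm _).trans_eq (by rw [LinearIsometry.norm_map])

/-- Coefficients of right translations are left uniformly continuous. -/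
noncomputable def rightCoeffOrbit (ν : Measure G) [ν.IsMulRightInvariant] [ν.Regular]
    (e : Lp ℝ 1 ν) (Λ : Lp ℝ 1 ν →L[ℝ] ℝ) : G →ᵇ (G →ᵇ ℝ) :=
  BoundedContinuousFunction.ofNormedAddCommGroup
    (fun s => (rightCoeff ν e Λ).compContinuous ⟨fun x => s * x, continuous_const_mul s⟩)
    (by
      refine continuous_iff_continuousAt.2 fun s₀ => ?_
      rw [ContinuousAt, tendsto_iff_norm_sub_tendsto_zero]
      have h0 : Tendsto (fun s => ‖Λ‖ * ‖rightTranslate ν s e - rightTranslate ν s₀ e‖)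
          (𝓝 s₀) (𝓝 (‖Λ‖ * 0)) :=
        (tendsto_iff_norm_sub_tendsto_zero.1
          (continuous_rightTranslate ν e).continuousAt).const_mul _
      rw [mul_zero] at h0
      refine squeeze_zero (fun _ => norm_nonneg _) (fun s => ?_) h0
      refine (BoundedContinuousFunction.norm_le (by positivity)).2 fun h => ?_
      change ‖Λ (rightTranslate ν (s * h) e) - Λ (rightTranslate ν (s₀ * h) e)‖ ≤ _
      -- The variable `h` enters only through the outer isometry `rightTranslate ν h`, so the bound
      -- is uniform in `h`.
      rw [← map_sub, rightTranslate_mul, rightTranslate_mul, ← map_sub]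
      exact (Λ.le_opNorm _).trans_eq (by rw [LinearIsometry.norm_map]))
    (‖Λ‖ * ‖e‖)
    fun s => (BoundedContinuousFunction.norm_le (by positivity)).2 fun h =>
      (Λ.le_opNorm _).trans_eq (by rw [LinearIsometry.norm_map])

/-- The orbit of the coefficient is continuous in sup norm, so the mean commutes with the integral.
By left invariance it is constant on the orbit, leaving a multiple of `∫ q = 0`. -/
theorem LeftInvariantMean.map_pairing_rightCoeffOrbit (M : LeftInvariantMean G) (μ ν : Measure G)
    [ν.IsMulRightInvariant] [ν.Regular] (e : Lp ℝ 1 ν) (Λ : Lp ℝ 1 ν →L[ℝ] ℝ) (q : Lp ℝ 1 μ)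
    (hq : ∫ s, q s ∂μ = 0) : M.toCLM (pairing μ (rightCoeffOrbit ν e Λ) q) = 0 := by
  have h (s : G) : M.toCLM (rightCoeffOrbit ν e Λ s) = M.toCLM (rightCoeff ν e Λ) :=
    M.left_invariant s (rightCoeff ν e Λ)
  rw [map_pairing]
  simp_rw [h, smul_eq_mul]
  rw [integral_mul_const, hq, zero_mul]

theorem pairing_rightCoeffOrbit_apply (μ ν : Measure G)
    [ν.IsMulRightInvariant] [ν.Regular] (e : Lp ℝ 1 ν) (Λ : Lp ℝ 1 ν →L[ℝ] ℝ) (q : Lp ℝ 1 μ)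
    (h : G) : pairing μ (rightCoeffOrbit ν e Λ) q h = Λ (pairing μ (rightOrbit ν e h) q) := by
  rw [map_pairing μ Λ]
  exact map_pairing μ (BoundedContinuousFunction.evalCLM ℝ h) (rightCoeffOrbit ν e Λ) q

/-- In an amenable group, finitely many functions of integral zero are simultaneously almost
annihilated by a convex combination of translations. -/
theorem LeftInvariantMean.exists_convexCombination (M : LeftInvariantMean G) (μ ν : Measure G)
    [ν.IsMulRightInvariant] [ν.Regular] (e : Lp ℝ 1 ν) {ι : Type*} [Fintype ι]
    (q : ι → Lp ℝ 1 μ) (hq : ∀ i, ∫ s, q i s ∂μ = 0) {ε : ℝ} (hε : 0 < ε) :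
    ∃ (κ : Type) (_ : Fintype κ) (c : κ → ℝ) (h : κ → G), (∀ j, 0 ≤ c j) ∧ ∑ j, c j = 1 ∧
      ∀ i, ‖∑ j, c j • pairing μ (rightOrbit ν e (h j)) (q i)‖ ≤ ε := by
  classical
  let w : G → ι → Lp ℝ 1 ν := fun h i => pairing μ (rightOrbit ν e h) (q i)
  have hmem : (0 : ι → Lp ℝ 1 ν) ∈ closure (convexHull ℝ (range w)) := by
    -- A separating functional `Λ` would give a bounded continuous function `h ↦ Λ (w h)` bounded
    -- below by some `a > 0`, yet of mean zero. Separating in the norm topology gives norm-small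
    -- combinations at once, for all `i` simultaneously.
    by_contra hn
    obtain ⟨Λ, a, h0, ha⟩ := geometric_hahn_banach_point_closed
      (convex_convexHull ℝ (range w)).closure isClosed_closure hn
    rw [map_zero] at h0
    let Λi : ι → Lp ℝ 1 ν →L[ℝ] ℝ := fun i =>
      Λ.comp (ContinuousLinearMap.single ℝ (fun _ : ι => Lp ℝ 1 ν) i)
    let W : G →ᵇ ℝ := ∑ i, pairing μ (rightCoeffOrbit ν e (Λi i)) (q i)
    have hW (h : G) : W h = Λ (w h) := by
      have hs : w h = ∑ i, Pi.single i (w h i) :=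
        (LinearMap.sum_single_apply (fun _ : ι => Lp ℝ 1 ν) (w h)).symm
      rw [hs, map_sum, BoundedContinuousFunction.sum_apply]
      refine Finset.sum_congr rfl fun i _ => ?_
      rw [pairing_rightCoeffOrbit_apply]
      rfl
    have hM : M.toCLM W = 0 := by
      rw [map_sum]
      exact Finset.sum_eq_zero fun i _ => M.map_pairing_rightCoeffOrbit μ ν e (Λi i) (q i) (hq i)
    have hle : a ≤ M.toCLM W := by
      rw [← M.map_const a]
      refine M.mono fun h => ?_
      rw [hW]
      exact (ha _ (subset_closure (subset_convexHull ℝ _ ⟨h, rfl⟩))).le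
    linarith
  obtain ⟨y, hy, hdist⟩ := Metric.mem_closure_iff.1 hmem ε hε
  obtain ⟨κ, hκ, c, z, hc, hc1, hz, hsum⟩ := mem_convexHull_iff_exists_fintype.1 hy
  choose h hh using hz
  refine ⟨κ, hκ, c, h, hc, hc1, fun i => ?_⟩
  have hyi : y i = ∑ j, c j • pairing μ (rightOrbit ν e (h j)) (q i) := by
    rw [← hsum, Finset.sum_apply]
    refine Finset.sum_congr rfl fun j _ => ?_
    rw [← hh j]
    rfl
  rw [← hyi]
  rw [dist_zero_left] at hdist
  exact (norm_le_pi_norm y i).trans hdist.le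

end Mean

/-! ### Almost invariant averages with universal weights -/

section Reiter

variable {G : Type u} [Group G] [TopologicalSpace G] [IsTopologicalGroup G]
  [T2Space G] [LocallyCompactSpace G] [SecondCountableTopology G] [MeasurableSpace G]
  [BorelSpace G]

/-- Normalized indicator functions concentrated near the identity. -/
theorem exists_L1_bump (ν : Measure G) [ν.IsOpenPosMeasure] [IsFiniteMeasureOnCompacts ν]
    {U : Set G} (hU : U ∈ 𝓝 (1 : G)) :
    ∃ (e : Lp ℝ 1 ν) (N : Set G), IsCompact N ∧ N ⊆ U ∧ (0 ≤ᵐ[ν] e) ∧ ∫ g, e g ∂ν = 1 ∧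
      ∀ᵐ g ∂ν, g ∉ N → e g = 0 := by
  obtain ⟨N, hN, hNU, hNc⟩ := local_compact_nhds hU
  have hm : MeasurableSet N := hNc.measurableSet
  have hfin : ν N ≠ ⊤ := hNc.measure_lt_top.ne
  have hpos : 0 < ν.real N := ENNReal.toReal_pos (Measure.measure_pos_of_mem_nhds ν hN).ne' hfin
  have hae := indicatorConstLp_coeFn (p := 1) (hs := hm) (hμs := hfin) (c := (ν.real N)⁻¹)
  refine ⟨indicatorConstLp 1 hm hfin (ν.real N)⁻¹, N, hNc, hNU, ?_, ?_, ?_⟩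
  · filter_upwards [hae] with g hg
    rw [hg]
    exact indicator_nonneg (fun _ _ => inv_nonneg.2 hpos.le) g
  · rw [integral_congr_ae hae, integral_indicator hm, setIntegral_const, smul_eq_mul,
      mul_inv_cancel₀ hpos.ne']
  · filter_upwards [hae] with g hg hgN
    rw [hg, indicator_of_notMem hgN]

variable {V : Type*} [NormedAddCommGroup V] [NormedSpace ℝ V]

/-- The orbit map `s ↦ τ (s * h) f` of a vector with continuous orbit. -/
noncomputable def repOrbit (τ : G → V →ₗᵢ[ℝ] V) {f : V} (hf : Continuous fun g => τ g f) (h : G) :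
    G →ᵇ V :=
  BoundedContinuousFunction.ofNormedAddCommGroup (fun s => τ (s * h) f)
    (hf.comp (continuous_mul_const h)) ‖f‖ fun s => by rw [LinearIsometry.norm_map]

theorem repOrbit_apply (τ : G → V →ₗᵢ[ℝ] V) {f : V} (hf : Continuous fun g => τ g f) (h s : G) :
    repOrbit τ hf h s = τ (s * h) f := rfl

theorem norm_repOrbit_le (τ : G → V →ₗᵢ[ℝ] V) {f : V} (hf : Continuous fun g => τ g f) (h : G) :
    ‖repOrbit τ hf h‖ ≤ ‖f‖ :=
  (BoundedContinuousFunction.norm_le (norm_nonneg _)).2 fun s => by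
    rw [repOrbit_apply, LinearIsometry.norm_map]

variable [CompleteSpace V] (μ ν : Measure G) [μ.IsMulLeftInvariant] [μ.Regular]
  [ν.IsMulRightInvariant] [ν.Regular] (τ : G → V →ₗᵢ[ℝ] V)
  (hτ : ∀ g h v, τ (g * h) v = τ g (τ h v)) {f : V} (hf : Continuous fun g => τ g f)

include hτ in
theorem rep_pairing_repOrbit_eq_integral (k h : G) (q : Lp ℝ 1 μ) :
    τ k (pairing μ (repOrbit τ hf h) q) = ∫ s, q s • τ (k * s * h) f ∂μ := by
  refine (map_pairing μ (τ k).toContinuousLinearMap (repOrbit τ hf h) q).trans ?_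
  refine integral_congr_ae (ae_of_all _ fun s => ?_)
  change q s • τ k (τ (s * h) f) = q s • τ (k * s * h) f
  rw [mul_assoc, hτ k]

-- Moves the group action from the representation to the density, so almost invariance of an average
-- becomes a question in `L¹(G)`.
include hτ in
theorem rep_pairing_repOrbit (k h : G) (q : Lp ℝ 1 μ) :
    τ k (pairing μ (repOrbit τ hf h) q) = pairing μ (repOrbit τ hf h) (leftTranslate μ k q) := by
  rw [rep_pairing_repOrbit_eq_integral μ τ hτ hf, pairing_apply,
    ← integral_mul_left_eq_self _ k⁻¹]
  refine integral_congr_ae ?_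
  filter_upwards [leftTranslate_ae μ k q] with s hs
  rw [hs, mul_inv_cancel_left, repOrbit_apply]

theorem pairing_repOrbit_rightTranslate (h : G) (e : Lp ℝ 1 ν) :
    pairing ν (repOrbit τ hf 1) (rightTranslate ν h e) = ∫ g, e g • τ (g * h) f ∂ν := by
  rw [pairing_apply, ← integral_mul_right_eq_self (fun g => e g • τ (g * h) f) h⁻¹]
  refine integral_congr_ae ?_
  filter_upwards [rightTranslate_ae ν h e] with g hg
  rw [hg, inv_mul_cancel_right, repOrbit_apply, mul_one]

-- Fubini: both sides are the double integral of `e(g) q(s) τ(g s h) f`. It lets smallness of the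
-- smoothed densities be transferred to any representation.
include hτ in
theorem pairing_repOrbit_pairing_rightOrbit [SigmaFinite μ] [SigmaFinite ν] (h : G)
    (e : Lp ℝ 1 ν) (q : Lp ℝ 1 μ) :
    pairing ν (repOrbit τ hf 1) (pairing μ (rightOrbit ν e h) q) =
      ∫ g, e g • pairing μ (repOrbit τ hf h) (leftTranslate μ g q) ∂ν := by
  have h1 : pairing ν (repOrbit τ hf 1) (pairing μ (rightOrbit ν e h) q) =
      ∫ s, ∫ g, (e g * q s) • τ (g * s * h) f ∂ν ∂μ := by
    rw [map_pairing μ]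
    refine integral_congr_ae (ae_of_all _ fun s => ?_)
    change q s • pairing ν (repOrbit τ hf 1) (rightTranslate ν (s * h) e) = _
    rw [pairing_repOrbit_rightTranslate, ← integral_smul]
    simp only [smul_smul, mul_comm, mul_assoc]
  have h2 (g : G) : e g • pairing μ (repOrbit τ hf h) (leftTranslate μ g q) =
      ∫ s, (e g * q s) • τ (g * s * h) f ∂μ := by
    rw [← rep_pairing_repOrbit μ τ hτ hf, rep_pairing_repOrbit_eq_integral μ τ hτ hf,
      ← integral_smul]
    simp only [smul_smul]
  simp_rw [h1, h2]
  refine (integral_integral_swap ?_).symm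
  refine Integrable.smul_bdd (φ := fun z : G × G => e z.1 * q z.2)
    (f := fun z : G × G => τ (z.1 * z.2 * h) f) ?_ ‖f‖ ?_ ?_
  · exact (L1.integrable_coeFn e).mul_prod (L1.integrable_coeFn q)
  · exact Continuous.aestronglyMeasurable (hf.comp (by fun_prop))
  · exact ae_of_all _ fun z => by rw [LinearIsometry.norm_map]

-- Smoothing by `e` costs little when `q` hardly moves under the support of `e`, since `e` is a
-- probability density and the pairing has norm at most `‖f‖`.
include hτ in
theorem norm_integral_pairing_leftTranslate_sub_le (h : G) {e : Lp ℝ 1 ν} (he0 : 0 ≤ᵐ[ν] e)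
    (he1 : ∫ g, e g ∂ν = 1) {N : Set G} (heN : ∀ᵐ g ∂ν, g ∉ N → e g = 0) {q : Lp ℝ 1 μ} {δ : ℝ}
    (hq : ∀ g ∈ N, ‖leftTranslate μ g q - q‖ ≤ δ) :
    ‖∫ g, e g • pairing μ (repOrbit τ hf h) (leftTranslate μ g q) ∂ν -
      pairing μ (repOrbit τ hf h) q‖ ≤ ‖f‖ * δ := by
  set B := pairing μ (repOrbit τ hf h)
  have hB (p : Lp ℝ 1 μ) : ‖B p‖ ≤ ‖f‖ * ‖p‖ :=
    (norm_pairing_le μ _ p).trans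
      (mul_le_mul_of_nonneg_right (norm_repOrbit_le τ hf h) (norm_nonneg _))
  have hei := L1.integrable_coeFn e
  have hc : B q = ∫ g, e g • B q ∂ν := by rw [integral_smul_const, he1, one_smul]
  have hint : Integrable (fun g => e g • B (leftTranslate μ g q)) ν :=
    hei.smul_bdd (‖f‖ * ‖q‖)
      ((B.continuous.comp (continuous_leftTranslate μ q)).aestronglyMeasurable)
      (ae_of_all _ fun g => (hB _).trans_eq (by rw [LinearIsometry.norm_map]))
  have hle : ‖∫ g, (e g • B (leftTranslate μ g q) - e g • B q) ∂ν‖ ≤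
      ∫ g, e g * (‖f‖ * δ) ∂ν := by
    refine norm_integral_le_of_norm_le (hei.mul_const _) ?_
    filter_upwards [he0, heN] with g hg0 hgN
    by_cases hg : g ∈ N
    · rw [← smul_sub, ← map_sub, norm_smul, Real.norm_of_nonneg hg0]
      exact mul_le_mul_of_nonneg_left
        ((hB _).trans (mul_le_mul_of_nonneg_left (hq g hg) (norm_nonneg _))) hg0
    · simp [hgN hg]
  rw [integral_sub hint (hei.smul_const _), ← hc, integral_mul_const, he1, one_mul] at hle
  exact hle

/-- A uniform version of the Reiter property: some averages of orbits are almost invariant, with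
the averaging weights independent of the representation. -/
theorem LeftInvariantMean.exists_almost_invariant_average {G : Type u} [Group G]
    [TopologicalSpace G] [IsTopologicalGroup G] [T2Space G] [LocallyCompactSpace G]
    [SecondCountableTopology G] [MeasurableSpace G] [BorelSpace G] (M : LeftInvariantMean G)
    (μ : Measure G) [μ.IsHaarMeasure] {K : Set G} (hK : IsCompact K) {ε : ℝ} (hε : 0 < ε) :
    ∃ (b : Lp ℝ 1 μ) (N : Set G) (κ : Type) (_ : Fintype κ) (c : κ → ℝ) (h : κ → G),
      IsCompact N ∧ (∀ᵐ g ∂μ, g ∉ N → b g = 0) ∧ ∫ g, b g ∂μ = 1 ∧ ∑ j, c j = 1 ∧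
      ∀ (V : Type*) [NormedAddCommGroup V] [NormedSpace ℝ V] [CompleteSpace V]
        (τ : G → V →ₗᵢ[ℝ] V) (_ : ∀ g h v, τ (g * h) v = τ g (τ h v)) (f : V)
        (hf : Continuous fun g => τ g f), ∀ k ∈ K,
        ‖τ k (∑ j, c j • pairing μ (repOrbit τ hf (h j)) b) -
          ∑ j, c j • pairing μ (repOrbit τ hf (h j)) b‖ ≤ ε * ‖f‖ := by
  classical
  obtain ⟨b, N, hN, -, -, hb1, hbN⟩ := exists_L1_bump μ (univ_mem : univ ∈ 𝓝 (1 : G))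
  -- Four errors of size `‖f‖ * δ` are added at the end: one from the finite cover, two from
  -- smoothing, one from the convex combination.
  set δ := ε / 4 with hδ
  have hδ0 : 0 < δ := by positivity
  have hcont := continuous_leftTranslate μ b
  obtain ⟨t, -, htf, htK⟩ : ∃ t ⊆ K, t.Finite ∧
      K ⊆ ⋃ k ∈ t, {g | ‖leftTranslate μ g b - leftTranslate μ k b‖ < δ} := by
    refine hK.elim_finite_subcover_image (fun k _ => ?_) fun k hk => ?_
    · exact isOpen_lt (hcont.sub continuous_const).norm continuous_const
    · exact mem_iUnion₂.2 ⟨k, hk, by simpa using hδ0⟩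
  -- The index `1` is adjoined so that `b` itself is among the densities almost fixed near the
  -- identity.
  let ι := ↥(htf.toFinset ∪ {1})
  have hU : {g : G | ∀ i : ι, ‖leftTranslate μ g (leftTranslate μ i.1 b) -
      leftTranslate μ i.1 b‖ ≤ δ} ∈ 𝓝 (1 : G) := by
    refine eventually_all.2 fun i => ?_
    have hc := ((continuous_leftTranslate μ (leftTranslate μ i.1 b)).sub
      (continuous_const (y := leftTranslate μ i.1 b))).norm.continuousAt (x := 1)
    simp only [ContinuousAt, Pi.sub_apply, leftTranslate_one, sub_self, norm_zero] at hc
    exact (hc.eventually_lt_const hδ0).mono fun _ h => h.le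
  obtain ⟨e, N', -, hN'U, he0, he1, heN'⟩ := exists_L1_bump μ.inv hU
  obtain ⟨κ, hκ, c, h, hc0, hc1, hch⟩ := M.exists_convexCombination μ μ.inv e
    (fun i : ι => leftTranslate μ i.1 b - b) (fun i => by
      rw [integral_congr_ae (Lp.coeFn_sub _ _)]
      simp only [Pi.sub_apply]
      rw [integral_sub (L1.integrable_coeFn _) (L1.integrable_coeFn _), integral_leftTranslate,
        sub_self]) hδ0
  refine ⟨b, N, κ, hκ, c, h, hN, hbN, hb1, hc1, fun V _ _ _ τ hτ f hf k hk => ?_⟩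
  let B : Lp ℝ 1 μ →L[ℝ] V := ∑ j, c j • pairing μ (repOrbit τ hf (h j))
  have hBapp (q : Lp ℝ 1 μ) : B q = ∑ j, c j • pairing μ (repOrbit τ hf (h j)) q := by
    simp [B]
  have hconv {v : κ → V} {r : ℝ} (hv : ∀ j, ‖v j‖ ≤ r) : ‖∑ j, c j • v j‖ ≤ r := by
    calc ‖∑ j, c j • v j‖ ≤ ∑ j, c j * r := norm_sum_le_of_le _ fun j _ => by
          rw [norm_smul, Real.norm_of_nonneg (hc0 j)]
          exact mul_le_mul_of_nonneg_left (hv j) (hc0 j)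
      _ = r := by rw [← Finset.sum_mul, hc1, one_mul]
  have hB (q : Lp ℝ 1 μ) : ‖B q‖ ≤ ‖f‖ * ‖q‖ := by
    rw [hBapp]
    exact hconv fun j => (norm_pairing_le μ _ q).trans
      (mul_le_mul_of_nonneg_right (norm_repOrbit_le τ hf (h j)) (norm_nonneg _))
  have hτB (g : G) (q : Lp ℝ 1 μ) : τ g (B q) = B (leftTranslate μ g q) := by
    simp only [hBapp, map_sum, map_smul, rep_pairing_repOrbit μ τ hτ hf]
  -- smoothing by `e`
  let T := pairing μ.inv (repOrbit τ hf 1)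
  let w : Lp ℝ 1 μ →ₗ[ℝ] Lp ℝ 1 μ.inv :=
    (∑ j, c j • (pairing μ (rightOrbit μ.inv e (h j))).toLinearMap)
  have hwapp (q : Lp ℝ 1 μ) : w q = ∑ j, c j • pairing μ (rightOrbit μ.inv e (h j)) q := by
    simp [w, LinearMap.sum_apply]
  have hTw (q : Lp ℝ 1 μ) (hq : ∀ g ∈ N', ‖leftTranslate μ g q - q‖ ≤ δ) :
      ‖T (w q) - B q‖ ≤ ‖f‖ * δ := by
    rw [hwapp, hBapp, map_sum, ← Finset.sum_sub_distrib]
    simp only [map_smul, ← smul_sub]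
    refine hconv fun j => ?_
    simp only [T]
    rw [pairing_repOrbit_pairing_rightOrbit μ μ.inv τ hτ hf]
    exact norm_integral_pairing_leftTranslate_sub_le μ μ.inv τ hτ hf (h j) he0 he1 heN' hq
  have hT (p : Lp ℝ 1 μ.inv) : ‖T p‖ ≤ ‖f‖ * ‖p‖ :=
    (norm_pairing_le μ.inv _ p).trans
      (mul_le_mul_of_nonneg_right (norm_repOrbit_le τ hf 1) (norm_nonneg _))
  obtain ⟨i, hi, hki⟩ := mem_iUnion₂.1 (htK hk)
  have hiι : i ∈ htf.toFinset ∪ {1} := by simp [hi]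
  have h1ι : (1 : G) ∈ htf.toFinset ∪ {1} := by simp
  have e1 : ‖B (leftTranslate μ k b - leftTranslate μ i b)‖ ≤ ‖f‖ * δ :=
    (hB _).trans (mul_le_mul_of_nonneg_left (le_of_lt hki) (norm_nonneg _))
  have e2 := hTw (leftTranslate μ i b) fun g hg => hN'U hg ⟨i, hiι⟩
  have e3 := hTw b fun g hg => by simpa [leftTranslate_one] using hN'U hg ⟨1, h1ι⟩
  have e4 : ‖T (w (leftTranslate μ i b - b))‖ ≤ ‖f‖ * δ := by
    refine (hT _).trans (mul_le_mul_of_nonneg_left ?_ (norm_nonneg _))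
    rw [hwapp]
    exact hch ⟨i, hiι⟩
  rw [← hBapp, hτB]
  -- Pass from `k` to the nearby net point `i`, then compare `B` with its smoothing `T ∘ w` at both
  -- `leftTranslate μ i b` and `b`; `T ∘ w` is small on their difference.
  have key : B (leftTranslate μ k b) - B b = B (leftTranslate μ k b - leftTranslate μ i b) -
      (T (w (leftTranslate μ i b)) - B (leftTranslate μ i b)) +
      T (w (leftTranslate μ i b - b)) + (T (w b) - B b) := by
    simp only [map_sub]
    abel
  rw [key]
  calc _ ≤ ‖f‖ * δ + ‖f‖ * δ + ‖f‖ * δ + ‖f‖ * δ :=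
        norm_add_le_of_le (norm_add_le_of_le (norm_sub_le_of_le e1 e2) e4) e3
    _ = ε * ‖f‖ := by rw [hδ]; ring

end Reiter

theorem Lp_two_norm_sq {X : Type*} [MeasurableSpace X] {m : Measure X} (u : Lp ℂ 2 m) :
    ‖u‖ ^ 2 = ∫ x, ‖u x‖ ^ 2 ∂m := by
  have h := L2.inner_def (𝕜 := ℂ) u u
  rw [inner_self_eq_norm_sq_to_K] at h
  have h2 : (∫ x, inner ℂ (u x) (u x) ∂m) = ((∫ x, ‖u x‖ ^ 2 ∂m : ℝ) : ℂ) := by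
    rw [← integral_complex_ofReal]
    refine integral_congr_ae (ae_of_all _ fun x => ?_)
    simp only [inner_self_eq_norm_sq_to_K]
    push_cast
    rfl
  rw [h2] at h
  exact Complex.ofReal_injective (by push_cast; exact h)

/-! ### From almost invariant `L¹` functions to vectors of `L²₀` -/

section Action

variable {G : Type u} [Group G] {X : Type*} [MeasurableSpace X] (m : Measure X)
  [MulAction G X] [MeasurableConstSMul G X] [SMulInvariantMeasure G X m]

/-- Translation `f ↦ f (g⁻¹ • ·)` on `L¹(X, m)`. -/
noncomputable def translateL1 (g : G) : Lp ℝ 1 m →ₗᵢ[ℝ] Lp ℝ 1 m :=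
  Lp.compMeasurePreservingₗᵢ ℝ (fun x : X => g⁻¹ • x) (measurePreserving_smul g⁻¹ m)

theorem translateL1_ae (g : G) (f : Lp ℝ 1 m) :
    translateL1 m g f =ᵐ[m] fun x => f (g⁻¹ • x) :=
  Lp.coeFn_compMeasurePreserving f (measurePreserving_smul g⁻¹ m)

theorem translateL1_mul (g h : G) (f : Lp ℝ 1 m) :
    translateL1 m (g * h) f = translateL1 m g (translateL1 m h f) := by
  apply Lp.ext
  refine (translateL1_ae m (g * h) f).trans ?_
  refine EventuallyEq.trans ?_ (translateL1_ae m g _).symm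
  refine EventuallyEq.trans ?_ ((measurePreserving_smul g⁻¹ m).quasiMeasurePreserving.ae_eq_comp
    (translateL1_ae m h f)).symm
  simp [Function.comp_def, mul_smul]

theorem integral_translateL1 (g : G) (f : Lp ℝ 1 m) :
    ∫ x, translateL1 m g f x ∂m = ∫ x, f x ∂m := by
  rw [integral_congr_ae (translateL1_ae m g f)]
  exact (measurePreserving_smul g⁻¹ m).integral_comp (measurableEmbedding_const_smul g⁻¹) _

theorem norm_translate_sub_sq (g : G) (u : Lp ℂ 2 m) :
    ‖translate m g u - u‖ ^ 2 = ∫ x, ‖u (g⁻¹ • x) - u x‖ ^ 2 ∂m := by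
  rw [Lp_two_norm_sq]
  refine integral_congr_ae ?_
  filter_upwards [Lp.coeFn_sub (translate m g u) u, translate_ae_eq m g u] with x h1 h2
  rw [h1, Pi.sub_apply, h2]

/-- The square root of an almost invariant integrable function of small support is, after
projection, an almost invariant vector in `L²₀`. -/
theorem exists_mem_L2Zero_of_L1 [IsProbabilityMeasure m] (F : Lp ℝ 1 m) {K₀ : Set X}
    (hK₀ : MeasurableSet K₀) (hm : 3 / 4 ≤ m.real K₀) (hF : ∀ᵐ x ∂m, x ∈ K₀ → F x = 0) :
    ∃ v ∈ L2Zero m, 3 / 7 * ‖F‖ ≤ ‖v‖ ^ 2 ∧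
      ∀ g : G, ‖translate m g v - v‖ ^ 2 ≤ ‖translateL1 m g F - F‖ := by
  have hFi := L1.integrable_coeFn F
  set φ : X → ℝ := fun x => √|F x| with hφ
  have hφm : AEStronglyMeasurable φ m :=
    Real.continuous_sqrt.comp_aestronglyMeasurable hFi.abs.aestronglyMeasurable
  have hφsq (x : X) : φ x ^ 2 = |F x| := Real.sq_sqrt (abs_nonneg _)
  have hφ2 : MemLp φ 2 m := by
    rw [memLp_two_iff_integrable_sq hφm]
    simp only [hφsq]
    exact hFi.abs
  have hφ1 : Integrable φ m := hφ2.integrable one_le_two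
  set c := ∫ x, φ x ∂m with hc
  have hψ : MemLp (fun x => φ x - c) 2 m := hφ2.sub (memLp_const c)
  have hψ' : MemLp (fun x => ((φ x - c : ℝ) : ℂ)) 2 m := hψ.ofReal
  have hae := hψ'.coeFn_toLp
  have hnorm : ‖hψ'.toLp‖ ^ 2 = ∫ x, (φ x - c) ^ 2 ∂m := by
    rw [Lp_two_norm_sq]
    refine integral_congr_ae ?_
    filter_upwards [hae] with x hx
    rw [hx, Complex.norm_real, Real.norm_eq_abs, sq_abs]
  have hsqi : Integrable (fun x => (φ x - c) ^ 2) m := hψ.integrable_sq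
  refine ⟨hψ'.toLp, ?_, ?_, fun g => ?_⟩
  · change ∫ x, hψ'.toLp _ x ∂m = 0
    rw [integral_congr_ae hae, integral_complex_ofReal, integral_sub hφ1 (integrable_const c)]
    simp [hc]
  · have h1 : ∫ x, (φ x - c) ^ 2 ∂m = ‖F‖ - c ^ 2 := by
      have : ∀ x, (φ x - c) ^ 2 = |F x| - 2 * c * φ x + c ^ 2 := fun x => by
        rw [← hφsq]; ring
      simp only [this]
      rw [integral_add (f := fun x => |F x| - 2 * c * φ x) (hFi.abs.sub (hφ1.const_mul _))
        (integrable_const _), integral_sub hFi.abs (hφ1.const_mul _), integral_const_mul, ← hc,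
        L1.norm_eq_integral_norm]
      simp only [Real.norm_eq_abs, integral_const, probReal_univ, smul_eq_mul]
      ring
    have h2 : c ^ 2 * m.real K₀ ≤ ∫ x, (φ x - c) ^ 2 ∂m := by
      have : ∫ x in K₀, (φ x - c) ^ 2 ∂m = c ^ 2 * m.real K₀ := by
        rw [setIntegral_congr_ae (g := fun _ => c ^ 2) hK₀, setIntegral_const, smul_eq_mul,
          mul_comm]
        filter_upwards [hF] with x hx hxK
        simp [hφ, hx hxK]
      rw [← this]
      exact setIntegral_le_integral hsqi (ae_of_all _ fun x => sq_nonneg _)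
    -- Here `‖v‖² = ‖F‖ - c²` and `‖v‖² ≥ 3/4 * c²`; eliminating `c²` gives the constant `3/7`.
    rw [hnorm]
    nlinarith [sq_nonneg c]
  · rw [norm_translate_sub_sq, L1.norm_eq_integral_norm]
    refine integral_mono_of_nonneg (ae_of_all _ fun x => by positivity)
      (L1.integrable_coeFn _).norm ?_
    filter_upwards [hae, (measurePreserving_smul g⁻¹ m).quasiMeasurePreserving.ae_eq_comp hae,
      Lp.coeFn_sub (translateL1 m g F) F, translateL1_ae m g F] with x h1 h2 h3 h4
    simp only [Function.comp_apply] at h2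
    rw [h1, h2, h3, Pi.sub_apply, h4, ← Complex.ofReal_sub, Complex.norm_real, Real.norm_eq_abs,
      sq_abs, Real.norm_eq_abs]
    have ha := hφsq (g⁻¹ • x)
    have hb := hφsq x
    have ha0 : 0 ≤ φ (g⁻¹ • x) := Real.sqrt_nonneg _
    have hb0 : 0 ≤ φ x := Real.sqrt_nonneg _
    have habs := abs_abs_sub_abs_le_abs_sub (F (g⁻¹ • x)) (F x)
    rw [← ha, ← hb] at habs
    -- For `a, b ≥ 0` one has `(a - b)² ≤ |a² - b²|`, because `|a - b| ≤ a + b`.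
    refine le_trans ?_ habs
    have : φ (g⁻¹ • x) ^ 2 - φ x ^ 2 = (φ (g⁻¹ • x) - φ x) * (φ (g⁻¹ • x) + φ x) := by ring
    rw [this, abs_mul, ← sq_abs, sq, abs_of_nonneg (add_nonneg ha0 hb0), sub_sub_sub_cancel_right]
    refine mul_le_mul_of_nonneg_left ?_ (abs_nonneg _)
    rw [abs_le]
    constructor <;> linarith

end Action

/-! ### Noncompact spaces: no spectral gap -/

section NonCompact

variable {G : Type u} [Group G] [TopologicalSpace G] [IsTopologicalGroup G]
  [T2Space G] [LocallyCompactSpace G] [SecondCountableTopology G]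
  {X : Type*} [TopologicalSpace X] [T2Space X] [LocallyCompactSpace X] [SigmaCompactSpace X]
  [MeasurableSpace X] [BorelSpace X] [MulAction G X] [ContinuousSMul G X]
  (m : Measure X) [IsProbabilityMeasure m] [SMulInvariantMeasure G X m]

/-- Bounded continuous functions have continuous orbits in `L¹`. -/
theorem continuous_translateL1_toL1 (f : C(X, ℝ)) (C : ℝ) (hf : ∀ x, ‖f x‖ ≤ C)
    (hfi : Integrable f m) :
    Continuous fun g : G => translateL1 m g (hfi.toL1 f) := by
  have hae (g : G) : translateL1 m g (hfi.toL1 f) =ᵐ[m] fun x => f (g⁻¹ • x) :=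
    (translateL1_ae m g _).trans
      ((measurePreserving_smul g⁻¹ m).quasiMeasurePreserving.ae_eq_comp hfi.coeFn_toL1)
  refine continuous_iff_continuousAt.2 fun g₀ => ?_
  rw [ContinuousAt, tendsto_iff_norm_sub_tendsto_zero]
  have hn (g : G) : ‖translateL1 m g (hfi.toL1 f) - translateL1 m g₀ (hfi.toL1 f)‖ =
      ∫ x, ‖f (g⁻¹ • x) - f (g₀⁻¹ • x)‖ ∂m := by
    rw [L1.norm_eq_integral_norm]
    refine integral_congr_ae ?_
    filter_upwards [Lp.coeFn_sub (translateL1 m g (hfi.toL1 f)) (translateL1 m g₀ (hfi.toL1 f)),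
      hae g, hae g₀] with x h1 h2 h3
    rw [h1, Pi.sub_apply, h2, h3]
  simp only [hn]
  have := tendsto_integral_filter_of_dominated_convergence (μ := m) (l := 𝓝 g₀)
    (F := fun g x => ‖f (g⁻¹ • x) - f (g₀⁻¹ • x)‖) (f := fun _ => 0) (fun _ => C + C)
    (Eventually.of_forall fun g => Continuous.aestronglyMeasurable (by fun_prop))
    (Eventually.of_forall fun g => ae_of_all _ fun x => by
      rw [norm_norm]
      exact norm_sub_le_of_le (hf _) (hf _))
    (integrable_const _)
    (ae_of_all _ fun x => by
      have hc : Continuous fun g : G => ‖f (g⁻¹ • x) - f (g₀⁻¹ • x)‖ := by fun_prop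
      simpa using hc.tendsto g₀)
  simpa using this

end NonCompact

section NonCompact

variable {G : Type u} [Group G] [TopologicalSpace G] [IsTopologicalGroup G]
  [T2Space G] [LocallyCompactSpace G] [SecondCountableTopology G]
  {X : Type*} [TopologicalSpace X] [T2Space X] [LocallyCompactSpace X] [SigmaCompactSpace X]
  [MeasurableSpace X] [BorelSpace X] [MulAction G X] [ContinuousSMul G X]
  (m : Measure X) [IsProbabilityMeasure m] [SMulInvariantMeasure G X m]

theorem exists_isCompact_measureReal_ge : ∃ K₀ : Set X, IsCompact K₀ ∧ 3 / 4 ≤ m.real K₀ := by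
  have h := tendsto_measure_iUnion_atTop (μ := m) (monotone_nat_of_le_succ fun n =>
    compactCovering_subset X n.le_succ)
  rw [iUnion_compactCovering, measure_univ] at h
  have h' : Tendsto (fun n => m.real (compactCovering X n)) atTop (𝓝 1) := by
    simpa [Measure.real, Function.comp_def] using
      (ENNReal.tendsto_toReal ENNReal.one_ne_top).comp h
  obtain ⟨n, hn⟩ := (h'.eventually_const_lt (show (3 / 4 : ℝ) < 1 by norm_num)).exists
  exact ⟨_, isCompact_compactCovering X n, hn.le⟩

/-- A nonnegative continuous integrable function vanishing on a proper compact subset. -/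
theorem exists_continuous_integral_pos [m.IsOpenPosMeasure] {Q : Set X} (hQ : IsCompact Q)
    (hQX : Q ≠ univ) : ∃ f : C(X, ℝ), (∀ x, f x ∈ Icc (0 : ℝ) 1) ∧ (∀ x ∈ Q, f x = 0) ∧
      0 < ∫ x, f x ∂m := by
  obtain ⟨x, hx⟩ := (ne_univ_iff_exists_notMem Q).1 hQX
  obtain ⟨f, hf1, hf0, -, hf⟩ := exists_continuous_one_zero_of_isCompact (isCompact_singleton (x := x))
    hQ.isClosed (disjoint_singleton_left.2 hx)
  refine ⟨f, hf, fun y hy => hf0 hy, ?_⟩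
  have hfi : Integrable f m := .of_bound (map_continuous f).aestronglyMeasurable 1
    (ae_of_all _ fun y => by rw [Real.norm_of_nonneg (hf y).1]; exact (hf y).2)
  refine (integral_pos_iff_support_of_nonneg (fun y => (hf y).1) hfi).2 ?_
  refine (map_continuous f).isOpen_support.measure_pos m ⟨x, ?_⟩
  rw [Function.mem_support, hf1 (mem_singleton x)]
  exact one_ne_zero

theorem not_hasSpectralGap_of_not_compactSpace [m.IsOpenPosMeasure] (M : LeftInvariantMean G)
    (hX : ¬ CompactSpace X) : ¬ HasSpectralGap m G := by
  let _ : MeasurableSpace G := borel G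
  have _ : BorelSpace G := ⟨rfl⟩
  rw [HasSpectralGap, not_not]
  intro K hK ε hε
  let μ : Measure G := Measure.haar
  obtain ⟨b, N, κ, _, c, h, hN, hbN, hb1, hc1, hinv⟩ :=
    -- Square roots turn `L¹` errors into squared `L²` errors, hence `ε ^ 2`. The factor `1/4`
    -- absorbs the loss `7/3` in the norm of `v`, as `7/12 < 1`.
    M.exists_almost_invariant_average μ hK (ε := ε ^ 2 / 4) (by positivity)
  obtain ⟨K₀, hK₀, hmK₀⟩ := exists_isCompact_measureReal_ge m
  -- All points at which `f` is evaluated when the average is computed on `K₀`.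
  let Q : Set X := ⋃ j, (fun z : G × X => (z.1 * h j)⁻¹ • z.2) '' (N ×ˢ K₀)
  have hQ : IsCompact Q := isCompact_iUnion fun j => (hN.prod hK₀).image (by fun_prop)
  have hQX : Q ≠ univ := fun hQu => hX ⟨hQu ▸ hQ⟩
  obtain ⟨f, hf01, hf0, hfpos⟩ := exists_continuous_integral_pos m hQ hQX
  have hfn (x : X) : ‖f x‖ ≤ 1 := by rw [Real.norm_of_nonneg (hf01 x).1]; exact (hf01 x).2
  have hfi : Integrable f m :=
    .of_bound (map_continuous f).aestronglyMeasurable 1 (ae_of_all _ hfn)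
  let f₁ : Lp ℝ 1 m := hfi.toL1 f
  have hcont : Continuous fun g : G => translateL1 m g f₁ :=
    continuous_translateL1_toL1 m f 1 hfn hfi
  have hmul : ∀ (g h : G) (v : Lp ℝ 1 m),
    translateL1 m (g * h) v = translateL1 m g (translateL1 m h v) := translateL1_mul m
  have hF := hinv (Lp ℝ 1 m) (translateL1 m) hmul f₁ hcont
  set F : Lp ℝ 1 m := ∑ j, c j • pairing μ (repOrbit (translateL1 m) hcont (h j)) b with hFdef
  have hf₁int : ∫ x, f₁ x ∂m = ∫ x, f x ∂m := integral_congr_ae hfi.coeFn_toL1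
  have hf₁norm : ‖f₁‖ = ∫ x, f x ∂m := by
    rw [L1.norm_eq_integral_norm]
    refine integral_congr_ae ?_
    filter_upwards [hfi.coeFn_toL1] with x hx
    rw [hx, Real.norm_of_nonneg (hf01 x).1]
  have hFint : ∫ x, F x ∂m = ∫ x, f x ∂m := by
    let I : Lp ℝ 1 m →L[ℝ] ℝ := L1.integralCLM (E := ℝ) (μ := m)
    have hI (p : Lp ℝ 1 m) : I p = ∫ x, p x ∂m :=
      (L1.integral_eq p).symm.trans (L1.integral_eq_integral p)
    have hj (j : κ) : I (c j • pairing μ (repOrbit (translateL1 m) hcont (h j)) b) =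
        c j * ∫ x, f x ∂m := by
      rw [map_smul, map_pairing μ I, smul_eq_mul]
      simp only [repOrbit_apply, hI, integral_translateL1, hf₁int, smul_eq_mul]
      rw [integral_mul_const, hb1, one_mul]
    rw [← hI, hFdef, map_sum, Finset.sum_congr rfl fun j _ => hj j, ← Finset.sum_mul, hc1, one_mul]
  have hFK₀ : ∀ᵐ x ∂m, x ∈ K₀ → F x = 0 := by
    -- `F` is a vector-valued integral, so its vanishing on `K₀` is checked by passing the
    -- continuous restriction map under the integral.
    let R := LpToLpRestrictCLM X ℝ ℝ m 1 K₀
    have hRF : R F = 0 := by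
      rw [hFdef, map_sum]
      refine Finset.sum_eq_zero fun j _ => ?_
      rw [map_smul, map_pairing μ R, integral_eq_zero_of_ae, smul_zero]
      filter_upwards [hbN] with s hs
      by_cases hsN : s ∈ N
      · have : R (translateL1 m (s * h j) f₁) = 0 := by
          apply Lp.ext
          refine (LpToLpRestrictCLM_coeFn ℝ K₀ _).trans ?_
          refine EventuallyEq.trans ?_ (Lp.coeFn_zero _ _ _).symm
          filter_upwards [ae_restrict_of_ae (translateL1_ae m (s * h j) f₁),
            ae_restrict_of_ae ((measurePreserving_smul (s * h j)⁻¹ m).quasiMeasurePreserving.ae_eq_comp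
              hfi.coeFn_toL1), ae_restrict_mem hK₀.measurableSet] with x h1 h2 h3
          rw [h1]
          exact h2.trans (hf0 _ (mem_iUnion.2 ⟨j, (s, x), ⟨hsN, h3⟩, rfl⟩))
        rw [repOrbit_apply, this, smul_zero]
        rfl
      · rw [hs hsN, zero_smul]
        rfl
    have h1 := LpToLpRestrictCLM_coeFn ℝ K₀ F
    rw [← ae_restrict_iff' hK₀.measurableSet]
    filter_upwards [h1, (Lp.eq_zero_iff_ae_eq_zero.1 hRF)] with x h2 h3
    exact h2.symm.trans h3
  have hFnorm : ‖f₁‖ ≤ ‖F‖ := by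
    rw [hf₁norm, ← hFint, L1.norm_eq_integral_norm]
    exact (Real.le_norm_self _).trans (norm_integral_le_integral_norm _)
  obtain ⟨v, hv, hvn, hvg⟩ := exists_mem_L2Zero_of_L1 (G := G) m F hK₀.measurableSet hmK₀ hFK₀
  have hf₁pos : 0 < ‖f₁‖ := hf₁norm ▸ hfpos
  have hvpos : 0 < ‖v‖ := by
    refine norm_pos_iff.2 fun h0 => ?_
    rw [h0, norm_zero] at hvn
    nlinarith
  refine ⟨⟨v, hv⟩, fun h0 => ?_, fun g hg => ?_⟩
  · rw [show v = 0 from congrArg Subtype.val h0, norm_zero] at hvpos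
    exact hvpos.false
  · change ‖translate m g v - v‖ < ε * ‖v‖
    refine lt_of_pow_lt_pow_left₀ 2 (by positivity) ?_
    have h1 := (hvg g).trans (hF g hg)
    have h2 : 0 < ε ^ 2 := by positivity
    rw [mul_pow]
    nlinarith

end NonCompact

theorem lintegral_enorm_sq_Lp {X : Type*} [MeasurableSpace X] {m : Measure X} (u : Lp ℂ 2 m) :
    ∫⁻ x, ‖u x‖ₑ ^ 2 ∂m = ENNReal.ofReal (‖u‖ ^ 2) := by
  rw [Lp_two_norm_sq, ofReal_integral_eq_lintegral_ofReal
    ((memLp_two_iff_integrable_sq_norm (Lp.aestronglyMeasurable u)).1 (Lp.memLp u))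
    (ae_of_all _ fun x => sq_nonneg _)]
  refine lintegral_congr fun x => ?_
  rw [ENNReal.ofReal_pow (norm_nonneg _), ofReal_norm]

/-- A function of integral zero is closer to `0` than to any other constant. -/
theorem norm_sq_le_lintegral_sub_const {X : Type*} [MeasurableSpace X] {m : Measure X}
    [IsProbabilityMeasure m] {u : Lp ℂ 2 m} (hu : u ∈ L2Zero m) (a : ℂ) :
    ENNReal.ofReal (‖u‖ ^ 2) ≤ ∫⁻ x, ‖u x - a‖ₑ ^ 2 ∂m := by
  have hum := Lp.memLp u
  have hi : Integrable (fun x => ‖u x - a‖ ^ 2) m :=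
    (memLp_two_iff_integrable_sq_norm
      (hum.sub (memLp_const a)).aestronglyMeasurable).1 (hum.sub (memLp_const a))
  have h1 : ∫⁻ x, ‖u x - a‖ₑ ^ 2 ∂m = ENNReal.ofReal (∫ x, ‖u x - a‖ ^ 2 ∂m) := by
    rw [ofReal_integral_eq_lintegral_ofReal hi (ae_of_all _ fun x => sq_nonneg _)]
    refine lintegral_congr fun x => ?_
    rw [ENNReal.ofReal_pow (norm_nonneg _), ofReal_norm]
  have hu1 : Integrable u m := hum.integrable one_le_two
  have hu2 : Integrable (fun x => ‖u x‖ ^ 2) m :=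
    (memLp_two_iff_integrable_sq_norm hum.aestronglyMeasurable).1 hum
  have hu0 : ∫ x, u x ∂m = 0 := hu
  let T : ℂ →L[ℝ] ℝ := innerSL ℝ a
  have hT : ∫ x, T (u x) ∂m = 0 := by rw [T.integral_comp_comm hu1, hu0, map_zero]
  rw [h1]
  refine ENNReal.ofReal_le_ofReal ?_
  have h2 (x : X) : ‖u x - a‖ ^ 2 = ‖u x‖ ^ 2 - 2 * T (u x) + ‖a‖ ^ 2 := by
    rw [norm_sub_sq_real, real_inner_comm]
    rfl
  simp only [h2]
  have hTi : Integrable (fun x => 2 * T (u x)) m := (T.integrable_comp hu1).const_mul 2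
  rw [integral_add (f := fun x => ‖u x‖ ^ 2 - 2 * T (u x)) (hu2.sub hTi) (integrable_const _),
    integral_sub hu2 hTi, integral_const_mul, hT, Lp_two_norm_sq]
  simp

/-! ### Compactly transitive actions: spectral gap -/

section Transitive

variable {G : Type u} [Group G] [TopologicalSpace G] [IsTopologicalGroup G]
  [T2Space G] [LocallyCompactSpace G] [SecondCountableTopology G]

section Haar

variable [MeasurableSpace G] [BorelSpace G]
  {X : Type*} [TopologicalSpace X] [SecondCountableTopology X]
  [MeasurableSpace X] [BorelSpace X] [MulAction G X] [ContinuousSMul G X]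
  (m : Measure X) [IsProbabilityMeasure m] [SMulInvariantMeasure G X m]

/-- Along any orbit, a right Haar measure controls an invariant measure of a uniformly
transitive action. -/
theorem mul_lintegral_le_setLIntegral_smul (ν : Measure G) [ν.IsMulRightInvariant] [SigmaFinite ν]
    {Q L : Set G} (hQ : IsCompact Q) (hL : IsCompact L) (hLX : ∀ x y : X, ∃ k ∈ L, k • x = y)
    {F : X → ENNReal} (hF : Measurable F) (x : X) :
    ν Q * ∫⁻ y, F y ∂m ≤ ∫⁻ g in Q * L, F (g • x) ∂ν := by
  have hswap : ∫⁻ y, ∫⁻ g in Q, F (g • y) ∂ν ∂m = ν Q * ∫⁻ y, F y ∂m := by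
    rw [lintegral_lintegral_swap]
    · have (g : G) : ∫⁻ y, F (g • y) ∂m = ∫⁻ y, F y ∂m :=
        (measurePreserving_smul g m).lintegral_comp hF
      simp only [this, lintegral_const, Measure.restrict_apply_univ]
      rw [mul_comm]
    · exact (hF.comp (continuous_snd.smul continuous_fst).measurable).aemeasurable
  -- Writing `y = k • x` with `k ∈ L`, the substitution `g ↦ g * k` preserves `ν` and carries `Q`
  -- into `Q * L`.
  have hle (y : X) : ∫⁻ g in Q, F (g • y) ∂ν ≤ ∫⁻ g in Q * L, F (g • x) ∂ν := by
    obtain ⟨k, hk, rfl⟩ := hLX x y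
    rw [← lintegral_indicator hQ.measurableSet, ← lintegral_indicator (hQ.mul hL).measurableSet,
      ← lintegral_mul_right_eq_self (indicator (Q * L) _) k]
    refine lintegral_mono fun g => ?_
    by_cases hg : g ∈ Q
    · rw [indicator_of_mem hg, indicator_of_mem (mul_mem_mul hg hk), mul_smul]
    · rw [indicator_of_notMem hg]
      exact zero_le
  rw [← hswap]
  calc _ ≤ ∫⁻ _, ∫⁻ g in Q * L, F (g • x) ∂ν ∂m := lintegral_mono hle
    _ = _ := by simp

end Haar

variable {X : Type*} [TopologicalSpace X] [SecondCountableTopology X]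
  [MeasurableSpace X] [BorelSpace X] [MulAction G X] [ContinuousSMul G X]
  (m : Measure X) [IsProbabilityMeasure m] [SMulInvariantMeasure G X m]

/-- Actions that are transitive through a compact set have spectral gap. -/
theorem hasSpectralGap_of_compact_transitive {L : Set G} (hL : IsCompact L)
    (hLX : ∀ x y : X, ∃ k ∈ L, k • x = y) : HasSpectralGap m G := by
  let _ : MeasurableSpace G := borel G
  have _ : BorelSpace G := ⟨rfl⟩
  let ν : Measure G := (Measure.haar : Measure G).inv
  obtain ⟨Q, hQ, hQ1⟩ := exists_compact_mem_nhds (1 : G)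
  have hQL : IsCompact (Q * L) := hQ.mul hL
  have hQpos : 0 < ν.real Q :=
    ENNReal.toReal_pos (Measure.measure_pos_of_mem_nhds ν hQ1).ne' hQ.measure_lt_top.ne
  set C := ν.real (Q * L)
  have hC : 0 ≤ C := measureReal_nonneg
  -- Chosen so that `ε² * C < ν.real Q`, contradicting the bound `ν.real Q * ‖v‖² ≤ ε² * ‖v‖² * C`
  -- derived below.
  have hε : 0 < √(ν.real Q / (C + 1)) := Real.sqrt_pos.2 (by positivity)
  intro hinv
  obtain ⟨⟨v, hv⟩, hv0, hvK⟩ := hinv (Q * L)⁻¹ hQL.inv _ hε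
  set ε := √(ν.real Q / (C + 1))
  have hvpos : 0 < ‖v‖ := norm_pos_iff.2 fun h => hv0 (Subtype.ext h)
  have hmeas : Measurable (v : X → ℂ) := (Lp.stronglyMeasurable v).measurable
  have h1 (x : X) : ν Q * ENNReal.ofReal (‖v‖ ^ 2) ≤
      ∫⁻ g in Q * L, ‖v (g • x) - v x‖ₑ ^ 2 ∂ν :=
    (mul_le_mul_right (norm_sq_le_lintegral_sub_const hv (v x)) _).trans
      (mul_lintegral_le_setLIntegral_smul m ν hQ hL hLX
        (F := fun y => ‖v y - v x‖ₑ ^ 2) ((hmeas.sub_const _).enorm.pow_const 2) x)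
  have h2 : ν Q * ENNReal.ofReal (‖v‖ ^ 2) ≤
      ∫⁻ g in Q * L, ∫⁻ x, ‖v (g • x) - v x‖ₑ ^ 2 ∂m ∂ν := by
    rw [lintegral_lintegral_swap]
    · calc ν Q * ENNReal.ofReal (‖v‖ ^ 2) = ∫⁻ _, ν Q * ENNReal.ofReal (‖v‖ ^ 2) ∂m := by simp
        _ ≤ _ := lintegral_mono h1
    · exact (((hmeas.comp (continuous_fst.smul continuous_snd).measurable).sub
        (hmeas.comp measurable_snd)).enorm.pow_const 2).aemeasurable
  have h3 : ∀ g ∈ Q * L, ∫⁻ x, ‖v (g • x) - v x‖ₑ ^ 2 ∂m ≤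
      ENNReal.ofReal (ε ^ 2 * ‖v‖ ^ 2) := by
    intro g hg
    have h := hvK g⁻¹ (inv_mem_inv.2 hg)
    change ‖translate m g⁻¹ v - v‖ < ε * ‖v‖ at h
    have h' : ∫⁻ x, ‖v (g • x) - v x‖ₑ ^ 2 ∂m = ENNReal.ofReal (‖translate m g⁻¹ v - v‖ ^ 2) := by
      rw [← lintegral_enorm_sq_Lp]
      refine lintegral_congr_ae ?_
      filter_upwards [Lp.coeFn_sub (translate m g⁻¹ v) v, translate_ae_eq m g⁻¹ v] with x h1 h2
      rw [h1, Pi.sub_apply, h2, inv_inv]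
    rw [h', ← mul_pow]
    exact ENNReal.ofReal_le_ofReal (pow_le_pow_left₀ (norm_nonneg _) h.le 2)
  have h4 : ν Q * ENNReal.ofReal (‖v‖ ^ 2) ≤ ENNReal.ofReal (ε ^ 2 * ‖v‖ ^ 2) * ν (Q * L) := by
    refine h2.trans ((setLIntegral_mono' hQL.measurableSet h3).trans_eq ?_)
    rw [setLIntegral_const]
  have h5 := ENNReal.toReal_mono
    (ENNReal.mul_ne_top ENNReal.ofReal_ne_top hQL.measure_lt_top.ne) h4
  rw [ENNReal.toReal_mul, ENNReal.toReal_mul, ENNReal.toReal_ofReal (by positivity),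
    ENNReal.toReal_ofReal (by positivity)] at h5
  change ν.real Q * ‖v‖ ^ 2 ≤ ε ^ 2 * ‖v‖ ^ 2 * C at h5
  have hεsq : ε ^ 2 = ν.real Q / (C + 1) := Real.sq_sqrt (by positivity)
  have h6 : ε ^ 2 * (C + 1) = ν.real Q := by rw [hεsq]; field_simp
  have h7 : 0 < ε ^ 2 * ‖v‖ ^ 2 := by positivity
  nlinarith

end Transitive

/-! ### Homogeneous spaces -/

section Quotient

variable {G : Type u} [Group G] [TopologicalSpace G] [IsTopologicalGroup G]
  [LocallyCompactSpace G] (H : Subgroup G)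

/-- Finitely many translates of a compact neighbourhood of `1` give a compact `C` surjecting onto
the quotient; then `C * C⁻¹` works. -/
theorem exists_compact_transitive_quotient [CompactSpace (G ⧸ H)] :
    ∃ L : Set G, IsCompact L ∧ ∀ x y : G ⧸ H, ∃ k ∈ L, k • x = y := by
  obtain ⟨V, hV, hV1⟩ := exists_compact_mem_nhds (1 : G)
  have hnhds : ∀ x : G ⧸ H, ((↑) '' (x.out • V) : Set (G ⧸ H)) ∈ 𝓝 x := fun x => by
    have h : x.out • V ∈ 𝓝 x.out := by simpa using smul_mem_nhds_smul x.out hV1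
    have := (QuotientGroup.isOpenMap_coe (N := H)).image_mem_nhds h
    rwa [QuotientGroup.out_eq'] at this
  obtain ⟨t, -, ht⟩ := isCompact_univ.elim_nhds_subcover _ fun x _ => hnhds x
  let C : Set G := ⋃ x ∈ t, x.out • V
  have hC : IsCompact C := t.isCompact_biUnion fun x _ => hV.smul _
  have hCs (x : G ⧸ H) : ∃ c ∈ C, (c : G ⧸ H) = x := by
    obtain ⟨z, hz, c, hc, hcx⟩ := mem_iUnion₂.1 (ht (mem_univ x))
    exact ⟨c, mem_iUnion₂.2 ⟨z, hz, hc⟩, hcx⟩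
  refine ⟨C * C⁻¹, hC.mul hC.inv, fun x y => ?_⟩
  obtain ⟨a, ha, rfl⟩ := hCs x
  obtain ⟨b, hb, rfl⟩ := hCs y
  refine ⟨b * a⁻¹, mul_mem_mul hb (inv_mem_inv.2 ha), ?_⟩
  rw [MulAction.Quotient.smul_coe, smul_eq_mul, inv_mul_cancel_right]

/-- By transitivity and second countability, countably many translates of a nonempty open set cover
the quotient, so a null one would make the whole measure zero. -/
theorem isOpenPosMeasure_of_smulInvariant_quotient [SecondCountableTopology G]
    [MeasurableSpace (G ⧸ H)] [BorelSpace (G ⧸ H)] (m : Measure (G ⧸ H))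
    [IsProbabilityMeasure m] [SMulInvariantMeasure G (G ⧸ H) m] : m.IsOpenPosMeasure := by
  refine ⟨fun U hU ⟨x, hx⟩ h0 => ?_⟩
  obtain ⟨T, hT, hTU⟩ := TopologicalSpace.isOpen_iUnion_countable (fun g : G => g • U)
    fun g => hU.smul g
  have huniv : ⋃ g ∈ T, g • U = univ := by
    rw [hTU]
    refine eq_univ_of_forall fun y => ?_
    obtain ⟨g, rfl⟩ := MulAction.exists_smul_eq G x y
    exact mem_iUnion.2 ⟨g, smul_mem_smul_set hx⟩
  have hz : m (⋃ g ∈ T, g • U) = 0 :=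
    (measure_biUnion_null_iff hT).2 fun g _ => by rw [measure_smul, h0]
  rw [huniv, measure_univ] at hz
  exact one_ne_zero hz

end Quotient

end AmenableLattice

theorem proposition1p4 {G : Type*} [Group G] [TopologicalSpace G] [IsTopologicalGroup G]
    [T2Space G] [LocallyCompactSpace G] [SecondCountableTopology G]
    (hG : AmenableLattice.IsAmenable G) :
    (∀ H : Subgroup G, AmenableLattice.HasFiniteCovolume H →
      (AmenableLattice.IsCocompact H ↔ AmenableLattice.IsWeaklyCocompact H)) ∧
    (∀ (X : Type*) [TopologicalSpace X] [T2Space X] [LocallyCompactSpace X] [SigmaCompactSpace X]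
      [MeasurableSpace X] [BorelSpace X] [MulAction G X] [ContinuousSMul G X]
      (m : MeasureTheory.Measure X) [MeasureTheory.IsProbabilityMeasure m]
      [MeasureTheory.SMulInvariantMeasure G X m] [m.IsOpenPosMeasure],
      ¬ CompactSpace X → ¬ AmenableLattice.HasSpectralGap m G) := by
  obtain ⟨M⟩ := hG
  refine ⟨fun H hH => ⟨fun hc => ?_, fun hw => ?_⟩, fun X _ _ _ _ _ _ _ _ m _ _ _ hX =>
    AmenableLattice.not_hasSpectralGap_of_not_compactSpace m M hX⟩
  · let _ : MeasurableSpace (G ⧸ H) := borel (G ⧸ H)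
    have _ : BorelSpace (G ⧸ H) := ⟨rfl⟩
    obtain ⟨hcl, m, hm, hinv⟩ := hH
    have := hc.2
    obtain ⟨L, hL, hLX⟩ := AmenableLattice.exists_compact_transitive_quotient H
    exact ⟨hcl, m, hm, hinv, AmenableLattice.hasSpectralGap_of_compact_transitive m hL hLX⟩
  · let _ : MeasurableSpace (G ⧸ H) := borel (G ⧸ H)
    have _ : BorelSpace (G ⧸ H) := ⟨rfl⟩
    obtain ⟨hcl, m, hm, hinv, hgap⟩ := hw
    -- Closedness of `H` makes `G ⧸ H` Hausdorff, as the noncompact case requires.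
    have : IsClosed (H : Set G) := hcl
    have := AmenableLattice.isOpenPosMeasure_of_smulInvariant_quotient H m
    refine ⟨hcl, not_not.1 fun hX => ?_⟩
    exact AmenableLattice.not_hasSpectralGap_of_not_compactSpace m M hX hgap
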